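/- \textbf{Setting.} Let $\mathbb H$ be the quaternions, $N$ the order and $I_1,\dots,I_N$ the sizes of the tensors considered. For $\mathcal P\in\mathbb H^{I_1\times\cdots\times I_N}$ let $P_{[k]}$ be the mode-$k$ unfolding, i.e. the quaternion matrix whose rows are indexed by the $k$-th index and whose columns are indexed by the remaining indices of $\mathcal P$. For quaternion matrices of equal size put $\langle A,B\rangle=\sum_{i,j}\overline{A_{ij}}B_{ij}$ and $\|A\|_F=\big(\sum_{i,j}|A_{ij}|^2\big)^{1/2}$, and let $\sigma_1(A)\ge\sigma_2(A)\ge\cdots\ge 0$ be the singular values of an $m\times n$ quaternion matrix $A$ (there are $\min(m,n)$ of them). Let $\phi_\gamma$ be one of the functions, for $x\ge 0$, $$\frac{(1+\gamma)x}{x+\gamma},\qquad 1-e^{-x/\gamma},\qquad \log(\gamma+x),\qquad w_ix,\qquad x^p,\qquad w_ix^p,$$ with $\gamma>0$, $0<p\le 1$ and weights $w_i\ge0$ that may depend on the position $i$ of the singular value, and put $\|A\|_{\phi_\gamma}=\sum_{i=1}^{\min(m,n)}\phi_\gamma(\sigma_i(A))$. For a real-valued function $f$ of a quaternion matrix, $\partial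 f(X)$ denotes the limiting (Mordukhovich) subdifferential with respect to the real inner product $\mathrm{Re}\langle\cdot,\cdot\rangle$: the set of all limits of sequences $(G_s)$ for which there are $X_s\to X$ with $f(X_s)\to f(X)$ such that each $G_s$ is a Fréchet subgradient of $f$ at $X_s$, that is, $f(Y)\ge f(X_s)+\mathrm{Re}\langle G_s,Y-X_s\rangle-o(\|Y-X_s\|_F)$ as $Y\to X_s$. Let $\mathcal O$ be the observed tensor and $\Omega$ the set of observed multi-indices; $\mathcal P_\Omega$ keeps the entries of $\mathcal P$ in $\Omega$ and replaces the others by $0$. Let $\alpha_k\ge0$ with $\sum_k\alpha_k=1$, and let $$\mathfrak L(\mathcal P,\{Q_k\},\{F_k\},\{\beta_k\})=\sum_{k=1}^N\Big(\alpha_k\|Q_k\|_{\phi_\gamma}+\mathrm{Re}\langle F_k,P_{[k]}-Q_k\rangle+\frac{\beta_k}{2}\|P_{[k]}-Q_k\|_F^2\Big).$$ Let $(\beta_k^{(\tau)})_{\tau\ge0}$, $k=1,\dots,N$, be positive non-decreasing sequences of penalty parameters (for example $\beta_k^{(\tau+1)}=\rho\,\beta_k^{(\tau)}$ with $\rho>1$).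 Starting from arbitrary $\mathcal P^{(0)},Q_k^{(0)},F_k^{(0)}$, the algorithm generates, for $\tau=0,1,2,\dots$: \begin{itemize} \item $\mathcal P^{(\tau+1)}=\mathcal T_{\Omega^c}+\mathcal O_\Omega$, where $\mathcal T$ is a minimizer of $\mathcal P\mapsto\mathfrak L(\mathcal P,\{Q_k^{(\tau)}\},\{F_k^{(\tau)}\},\{\beta_k^{(\tau)}\})$ over all tensors; \item $\{Q_k^{(\tau+1)}\}$, a (global) minimizer of $\{Q_k\}\mapsto\mathfrak L(\mathcal P^{(\tau+1)},\{Q_k\},\{F_k^{(\tau)}\},\{\beta_k^{(\tau)}\})$; \item $F_k^{(\tau+1)}=F_k^{(\tau)}-\beta_k^{(\tau)}\big(Q_k^{(\tau+1)}-P_{[k]}^{(\tau+1)}\big)$ for $k=1,\dots,N$. \end{itemize} \textbf{Theorem.} Assume that for every $k$ $$\sum_{\tau\ge1}\frac{\beta_k^{(\tau)}+\beta_k^{(\tau-1)}}{2\,(\beta_k^{(\tau-1)})^2}<\infty .$$ Then every accumulation point $(\mathcal P^*,\{Q_k^*\},\{F_k^*\})$ of the sequence $(\mathcal P^{(\tau)},\{Q_k^{(\tau)}\},\{F_k^{(\tau)}\})_{\tau}$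 satisfies the KKT conditions $$P^*_{[k]}=Q_k^*\ \ (k=1,\dots,N),\qquad \mathcal P^*_\Omega=\mathcal O_\Omega,\qquad F_k^*\in\alpha_k\,\partial\|\cdot\|_{\phi_\gamma}(Q_k^*)\ \ (k=1,\dots,N).$$ -/

import Mathlib

open scoped Quaternion Topology
open Filter

noncomputable section

namespace QTC

/-- Quaternion matrices with rows indexed by `m` and columns indexed by `n`. -/
abbrev QMat (m n : Type*) := Matrix m n ℍ[ℝ]

/-- The right inner product `∑ conj (A i j) * B i j` of two quaternion matrices. -/
def qinner {m n : Type*} [Fintype m] [Fintype n] (A B : QMat m n) : ℍ[ℝ] :=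
  ∑ i, ∑ j, star (A i j) * B i j

/-- The Frobenius norm of a quaternion matrix. -/
def frobNorm {m n : Type*} [Fintype m] [Fintype n] (A : QMat m n) : ℝ :=
  √(∑ i, ∑ j, ‖A i j‖ ^ 2)

/-- First Cayley-Dickson component: `q = cdA q + cdB q * j`, so `cdA q = q₀ + q₁ i`. -/
def cdA (q : ℍ[ℝ]) : ℂ := ⟨q.re, q.imI⟩

/-- Second Cayley-Dickson component: `q = cdA q + cdB q * j`, so `cdB q = q₂ + q₃ i`. -/
def cdB (q : ℍ[ℝ]) : ℂ := ⟨q.imJ, q.imK⟩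

/-- The complex adjoint matrix `[[A, B], [-conj B, conj A]]` of `Q = A + B j`. The map
`Q ↦ complexAdjoint Q` is the usual injective `*`-homomorphism from quaternion matrices to
complex matrices of doubled size. -/
def complexAdjoint {m n : Type*} (Q : QMat m n) : Matrix (m ⊕ m) (n ⊕ n) ℂ :=
  Matrix.fromBlocks (Q.map cdA) (Q.map cdB)
    (Q.map fun q => -star (cdB q)) (Q.map fun q => star (cdA q))

/-- The `i`-th singular value (counted from `0`, in descending order) of a quaternion matrix `Q`.
If `Q = U diag(σ₀, σ₁, …) Vᴴ` is a quaternion singular value decomposition, applying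
`complexAdjoint` gives a complex one in which each `σᵢ` occurs exactly twice; so `σᵢ` is the
singular value with number `2 i` of the complex adjoint matrix. -/
def singularValue {m n : Type*} [Fintype m] [Fintype n] [DecidableEq n]
    (Q : QMat m n) (i : ℕ) : ℝ :=
  (Matrix.toEuclideanLin (complexAdjoint Q)).singularValues (2 * i)

/-- The surrogate functions of the rank, with their parameters. The weights of the weighted
norms depend on the position of the singular value. -/
inductive Surrogate where
  | geman (γ : ℝ) (hγ : 0 < γ)
  | laplace (γ : ℝ) (hγ : 0 < γ)
  | logarithm (γ : ℝ) (hγ : 0 < γ)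
  | weightedNuclear (w : ℕ → ℝ) (hw : ∀ i, 0 ≤ w i)
  | schatten (p : ℝ) (hp : 0 < p) (hp1 : p ≤ 1)
  | weightedSchatten (w : ℕ → ℝ) (hw : ∀ i, 0 ≤ w i) (p : ℝ) (hp : 0 < p) (hp1 : p ≤ 1)

/-- The value `φ(x)`, `x ≥ 0`, of a surrogate function, applied to the `i`-th singular value. -/
def Surrogate.eval : Surrogate → ℕ → ℝ → ℝ
  | .geman γ _, _, x => (1 + γ) * x / (x + γ)
  | .laplace γ _, _, x => 1 - Real.exp (-(x / γ))
  | .logarithm γ _, _, x => Real.log (γ + x)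
  | .weightedNuclear w _, i, x => w i * x
  | .schatten p _ _, _, x => x ^ p
  | .weightedSchatten w _ p _ _, i, x => w i * x ^ p

/-- The `φ`-norm `‖Q‖_φ = ∑ᵢ φ(σᵢ(Q))`, over the `min(m, n)` singular values of an
`m × n` quaternion matrix. -/
def phiNorm {m n : Type*} [Fintype m] [Fintype n] [DecidableEq n]
    (φ : Surrogate) (Q : QMat m n) : ℝ :=
  ∑ i ∈ Finset.range (min (Fintype.card m) (Fintype.card n)), φ.eval i (singularValue Q i)

/-- `G` is a regular (Fréchet) subgradient of `f` at `X`, for the real inner product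
`Re ⟨·, ·⟩`: `f Y ≥ f X + Re ⟨G, Y - X⟩ - o(‖Y - X‖_F)` as `Y → X`. -/
def IsRegularSubgradient {m n : Type*} [Fintype m] [Fintype n]
    (f : QMat m n → ℝ) (X G : QMat m n) : Prop :=
  ∀ ε : ℝ, 0 < ε → ∀ᶠ Y in 𝓝 X, f X + (qinner G (Y - X)).re - ε * frobNorm (Y - X) ≤ f Y

/-- The (limiting, or Mordukhovich) subdifferential of `f` at `X`: all limits of regular
subgradients of `f` at points `Xₛ → X` with `f Xₛ → f X`. -/
def subdifferential {m n : Type*} [Fintype m] [Fintype n]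
    (f : QMat m n → ℝ) (X : QMat m n) : Set (QMat m n) :=
  {G | ∃ (Xs Gs : ℕ → QMat m n), Tendsto Xs atTop (𝓝 X) ∧
    Tendsto (fun s => f (Xs s)) atTop (𝓝 (f X)) ∧
    (∀ s, IsRegularSubgradient f (Xs s) (Gs s)) ∧ Tendsto Gs atTop (𝓝 G)}

/-- Quaternion tensors of size `I 0 × ⋯ × I (N - 1)`. -/
abbrev QTensor {N : ℕ} (I : Fin N → ℕ) := (∀ l, Fin (I l)) → ℍ[ℝ]

/-- The column indices of the mode-`k` unfolding: tuples of the indices of all other modes. -/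
abbrev ColIndex {N : ℕ} (I : Fin N → ℕ) (k : Fin N) := ∀ l : {l : Fin N // l ≠ k}, Fin (I l)

/-- The matrices that have the size of the mode-`k` unfolding. -/
abbrev UnfoldMat {N : ℕ} (I : Fin N → ℕ) (k : Fin N) := QMat (Fin (I k)) (ColIndex I k)

/-- The mode-`k` unfolding of a tensor. The entry in row `i` and column `j` is the entry of the
tensor with `k`-th index `i` and other indices `j`. -/
def unfold {N : ℕ} {I : Fin N → ℕ} (k : Fin N) (T : QTensor I) : UnfoldMat I k :=
  Matrix.of fun i j => T ((Equiv.piSplitAt k fun l => Fin (I l)).symm (i, j))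

/-- The operation `T ↦ T_Ω` that keeps the entries in `Ω` and replaces the others by `0`. -/
def restrict {N : ℕ} {I : Fin N → ℕ} (Ω : Set (∀ l, Fin (I l))) (T : QTensor I) : QTensor I :=
  Ω.indicator T

/-- The augmented Lagrangian of
`min ∑ₖ αₖ ‖Qₖ‖_φ` subject to `P_[k] = Qₖ` for all `k`, with multipliers `F` and
penalty parameters `β`. -/
def lagrangian {N : ℕ} {I : Fin N → ℕ} (φ : Surrogate) (α : Fin N → ℝ)
    (P : QTensor I) (Q F : ∀ k, UnfoldMat I k) (β : Fin N → ℝ) : ℝ :=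
  ∑ k, (α k * phiNorm φ (Q k) + (qinner (F k) (unfold k P - Q k)).re
    + β k / 2 * frobNorm (unfold k P - Q k) ^ 2)

/-- `(P, Q, F)` is a sequence generated by the alternating direction method of multipliers for
low-rank quaternion tensor completion with observed data `O` on the index set `Ω`, with the
penalty parameters `β`. The values at `τ = 0` are arbitrary. -/
structure IsADMMSequence {N : ℕ} {I : Fin N → ℕ} (φ : Surrogate) (α : Fin N → ℝ)
    (Ω : Set (∀ l, Fin (I l))) (O : QTensor I) (β : ℕ → Fin N → ℝ)
    (P : ℕ → QTensor I) (Q F : ℕ → ∀ k, UnfoldMat I k) : Prop where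
  /-- `P` is updated by a minimizer of the Lagrangian, whose entries in `Ω` are then replaced
  by the observed ones. -/
  update_P : ∀ τ, ∃ T : QTensor I,
    (∀ T' : QTensor I, lagrangian φ α T (Q τ) (F τ) (β τ) ≤ lagrangian φ α T' (Q τ) (F τ) (β τ)) ∧
    P (τ + 1) = restrict Ωᶜ T + restrict Ω O
  /-- `Q` is updated by a minimizer of the Lagrangian. -/
  update_Q : ∀ τ, ∀ Q' : ∀ k, UnfoldMat I k,
    lagrangian φ α (P (τ + 1)) (Q (τ + 1)) (F τ) (β τ) ≤
      lagrangian φ α (P (τ + 1)) Q' (F τ) (β τ)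
  /-- The update of the multipliers. -/
  update_F : ∀ τ k, F (τ + 1) k = F τ k - β τ k • (Q (τ + 1) k - unfold k (P (τ + 1)))

end QTC

end

/-! ### Weyl's perturbation inequality for singular values -/

section Weyl

open Module

variable {𝕜 E E' : Type*} [RCLike 𝕜]
  [NormedAddCommGroup E] [InnerProductSpace 𝕜 E] [FiniteDimensional 𝕜 E]
  [NormedAddCommGroup E'] [InnerProductSpace 𝕜 E'] [FiniteDimensional 𝕜 E']

/-! The Q-step is a proximal step: with `Z = F/β + P_[k]`, the new `Q` minimizes `α‖·‖_φ + β/2 ‖Z -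
·‖²`, and the new multiplier is `β (Z - Q)`. This is used in two ways.

Feasibility: testing minimality against `Z` itself bounds `(‖F‖/β)²` by a multiple of `(1 +
‖F‖/β)/β`, since `‖·‖_φ` varies at most affinely with distance (`exists_phiNorm_sub_le`). The
summability hypothesis forces `β → ∞`, so `‖F‖/β → 0` with no bound on the multipliers themselves.
As `β (P_[k] - Q)` is a difference of consecutive multipliers, `P_[k] - Q → 0`.

Stationarity: for `α > 0`, minimality makes `F/α` a Fréchet subgradient at `Q`, and continuity of
`‖·‖_φ`, from Weyl's inequality, carries this to the limit. For `α = 0` the multiplier vanishes, and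
what remains is that the limiting subdifferential is nonempty (`subdifferential_nonempty`). -/

theorem LinearMap.sq_norm_apply_eq_sum_singularValues (T : E →ₗ[𝕜] E') (x : E) :
    ‖T x‖ ^ 2 = ∑ j : Fin (finrank 𝕜 E), T.singularValues j ^ 2 *
      ‖inner 𝕜 (T.isSymmetric_adjoint_comp_self.eigenvectorBasis rfl j) x‖ ^ 2 := by
  set hT := T.isSymmetric_adjoint_comp_self
  set b := hT.eigenvectorBasis rfl
  have h1 : ((‖T x‖ ^ 2 : ℝ) : 𝕜) = inner 𝕜 x ((adjoint T ∘ₗ T) x) := by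
    rw [LinearMap.comp_apply, LinearMap.adjoint_inner_right, inner_self_eq_norm_sq_to_K]
    norm_cast
  have h2 : ((‖T x‖ ^ 2 : ℝ) : 𝕜) = ((∑ j : Fin (finrank 𝕜 E), T.singularValues j ^ 2 *
      ‖inner 𝕜 (b j) x‖ ^ 2 : ℝ) : 𝕜) := by
    rw [h1, ← b.sum_inner_mul_inner]
    rw [RCLike.ofReal_sum]
    refine Finset.sum_congr rfl fun j _ => ?_
    have h3 : inner 𝕜 (b j) ((adjoint T ∘ₗ T) x) =
        (T.singularValues j ^ 2 : ℝ) * inner 𝕜 (b j) x := by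
      rw [← hT, hT.apply_eigenvectorBasis rfl j, inner_smul_left, T.sq_singularValues_fin rfl j]
      simp [b]
    rw [h3]
    push_cast
    rw [← RCLike.conj_mul, inner_conj_symm]
    ring
  exact_mod_cast h2

/-- By a dimension count, some `x ≠ 0` is orthogonal to the right singular vectors of `T` beyond `i`
and to those of `S` before `i`. For it, `σᵢ(T)‖x‖ ≤ ‖T x‖` and `‖S x‖ ≤ σᵢ(S)‖x‖`. -/
theorem LinearMap.singularValues_le_add (T S : E →ₗ[𝕜] E') {C : ℝ}
    (hC : ∀ x, ‖T x - S x‖ ≤ C * ‖x‖) (hC0 : 0 ≤ C) (i : ℕ) :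
    T.singularValues i ≤ S.singularValues i + C := by
  by_cases hi : finrank 𝕜 E ≤ i
  · rw [T.singularValues_of_finrank_le hi]
    exact add_nonneg (S.singularValues_nonneg i) hC0
  push Not at hi
  set bT := T.isSymmetric_adjoint_comp_self.eigenvectorBasis rfl with hbT
  set bS := S.isSymmetric_adjoint_comp_self.eigenvectorBasis rfl with hbS
  -- Index `i` imposes no condition in either basis, so there is one functional fewer than the
  -- dimension.
  let A : E →ₗ[𝕜] ({j : Fin (finrank 𝕜 E) // j ≠ ⟨i, hi⟩} → 𝕜) := LinearMap.pi fun j =>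
    (innerSL 𝕜 (if i < (j : Fin (finrank 𝕜 E)) then bT j else bS j)).toLinearMap
  have hA : LinearMap.ker A ≠ ⊥ := by
    apply LinearMap.ker_ne_bot_of_finrank_lt
    rw [finrank_fintype_fun_eq_card, Fintype.card_subtype_compl]
    simp
    omega
  obtain ⟨x, hxA, hx0⟩ := Submodule.exists_mem_ne_zero_of_ne_bot hA
  have hx : ∀ j : Fin (finrank 𝕜 E), j ≠ ⟨i, hi⟩ →
      inner 𝕜 (if i < (j : ℕ) then bT j else bS j) x = 0 := fun j hj =>
    congrFun (LinearMap.mem_ker.1 hxA) ⟨j, hj⟩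
  have hTx : T.singularValues i * ‖x‖ ≤ ‖T x‖ := by
    refine le_of_sq_le_sq ?_ (norm_nonneg _)
    rw [mul_pow, T.sq_norm_apply_eq_sum_singularValues, ← bT.sum_sq_norm_inner_right x, Finset.mul_sum]
    refine Finset.sum_le_sum fun j _ => ?_
    by_cases hj : i < (j : ℕ)
    · have := hx j (by rintro rfl; simp at hj)
      rw [if_pos hj] at this
      simp [this, ← hbT]
    · gcongr
      · exact T.singularValues_nonneg _
      · exact T.singularValues_antitone (not_lt.1 hj)
  have hSx : ‖S x‖ ≤ S.singularValues i * ‖x‖ := by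
    refine le_of_sq_le_sq ?_ (mul_nonneg (S.singularValues_nonneg _) (norm_nonneg _))
    rw [mul_pow, S.sq_norm_apply_eq_sum_singularValues, ← bS.sum_sq_norm_inner_right x, Finset.mul_sum]
    refine Finset.sum_le_sum fun j _ => ?_
    by_cases hj : (j : ℕ) < i
    · have := hx j (by rintro rfl; simp at hj)
      rw [if_neg (by omega)] at this
      simp [this, ← hbS]
    · gcongr
      · exact S.singularValues_nonneg _
      · exact S.singularValues_antitone (not_lt.1 hj)
  have hxpos : 0 < ‖x‖ := norm_pos_iff.2 hx0
  have := norm_le_norm_add_norm_sub' (T x) (S x)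
  refine le_of_mul_le_mul_right ?_ hxpos
  linarith [hC x]

end Weyl

namespace QTC

/-! ### Scalar estimates for the surrogate functions -/

section Eval

theorem Surrogate.continuousOn_eval (φ : Surrogate) (i : ℕ) :
    ContinuousOn (φ.eval i) (Set.Ici 0) := by
  cases φ with
  | geman γ hγ =>
    refine ContinuousOn.div (by fun_prop) (by fun_prop) fun x hx => ?_
    rw [Set.mem_Ici] at hx
    positivity
  | laplace γ hγ =>
    have : Continuous fun x : ℝ => 1 - Real.exp (-(x / γ)) := by fun_prop
    exact this.continuousOn
  | logarithm γ hγ =>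
    refine ContinuousOn.log (by fun_prop) fun x hx => ?_
    rw [Set.mem_Ici] at hx
    positivity
  | weightedNuclear w hw => exact (continuous_const.mul continuous_id).continuousOn
  | schatten p hp hp1 => exact (Real.continuous_rpow_const hp.le).continuousOn
  | weightedSchatten w hw p hp hp1 =>
    exact (continuous_const.mul (Real.continuous_rpow_const hp.le)).continuousOn

theorem Surrogate.eval_zero_le (φ : Surrogate) (i : ℕ) {x : ℝ} (hx : 0 ≤ x) :
    φ.eval i 0 ≤ φ.eval i x := by
  cases φ with
  | geman γ hγ => simp only [Surrogate.eval, mul_zero, zero_div]; positivity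
  | laplace γ hγ =>
    simp only [Surrogate.eval]
    gcongr
  | logarithm γ hγ =>
    simp only [Surrogate.eval]
    gcongr
  | weightedNuclear w hw =>
    simpa [Surrogate.eval] using mul_nonneg (hw i) hx
  | schatten p hp hp1 =>
    simp only [Surrogate.eval, Real.zero_rpow hp.ne']; positivity
  | weightedSchatten w hw p hp hp1 =>
    simpa [Surrogate.eval, Real.zero_rpow hp.ne'] using mul_nonneg (hw i) (Real.rpow_nonneg hx p)

theorem Surrogate.differentiableAt_eval (φ : Surrogate) (i : ℕ) {x : ℝ} (hx : 0 < x) :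
    DifferentiableAt ℝ (φ.eval i) x := by
  cases φ with
  | geman γ hγ =>
    exact DifferentiableAt.div (by fun_prop) (by fun_prop) (by positivity)
  | laplace γ hγ =>
    change DifferentiableAt ℝ (fun x : ℝ => 1 - Real.exp (-(x / γ))) x
    fun_prop
  | logarithm γ hγ => exact DifferentiableAt.log (by fun_prop) (by positivity)
  | weightedNuclear w hw =>
    change DifferentiableAt ℝ (fun x : ℝ => w i * x) x
    fun_prop
  | schatten p hp hp1 => exact Real.differentiableAt_rpow_const_of_ne p hx.ne'
  | weightedSchatten w hw p hp hp1 =>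
    exact (Real.differentiableAt_rpow_const_of_ne p hx.ne').const_mul (w i)

/-- Only a lower bound is possible, since `x ^ p` has infinite slope at `0`; there minimality gives
`L = 0`, and elsewhere differentiability gives `L`. -/
theorem Surrogate.eventually_eval_ge (φ : Surrogate) (i : ℕ) {x : ℝ} (hx : 0 ≤ x) :
    ∃ L : ℝ, 0 ≤ L ∧ ∀ᶠ y in 𝓝 x, 0 ≤ y → φ.eval i x - L * |y - x| ≤ φ.eval i y := by
  rcases hx.eq_or_lt with rfl | hx
  · refine ⟨0, le_rfl, Eventually.of_forall fun y hy => ?_⟩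
    simpa using φ.eval_zero_le i hy
  · obtain ⟨L, hL, h⟩ := (φ.differentiableAt_eval i hx).hasDerivAt.isBigO_sub.exists_nonneg
    refine ⟨L, hL, h.bound.mono fun y hy _ => ?_⟩
    rw [Real.norm_eq_abs, Real.norm_eq_abs] at hy
    linarith [neg_abs_le (φ.eval i y - φ.eval i x)]

theorem _root_.Real.rpow_sub_rpow_le {p x y : ℝ} (hp : 0 < p) (hp1 : p ≤ 1) (hx : 0 ≤ x)
    (hy : 0 ≤ y) : x ^ p - y ^ p ≤ 1 + |x - y| := by
  have h1 : x ^ p ≤ (|x - y| + y) ^ p :=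
    Real.rpow_le_rpow hx (by linarith [le_abs_self (x - y)]) hp.le
  have h2 := Real.rpow_add_le_add_rpow (abs_nonneg (x - y)) hy hp.le hp1
  have h3 : |x - y| ^ p ≤ (1 + |x - y|) ^ p := by gcongr; linarith
  have h4 : (1 + |x - y|) ^ p ≤ (1 + |x - y|) ^ (1 : ℝ) :=
    Real.rpow_le_rpow_of_exponent_le (by linarith [abs_nonneg (x - y)]) hp1
  rw [Real.rpow_one] at h4
  linarith

/-- The constant term absorbs the failure of `x ^ p` to be Lipschitz at `0`; the linear term absorbs
growth at infinity. -/
theorem Surrogate.exists_eval_sub_le (φ : Surrogate) (i : ℕ) :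
    ∃ C : ℝ, 0 ≤ C ∧ ∀ x y : ℝ, 0 ≤ x → 0 ≤ y →
      φ.eval i x - φ.eval i y ≤ C * (1 + |x - y|) := by
  cases φ with
  | geman γ hγ =>
    refine ⟨1 + γ, by positivity, fun x y hx hy => ?_⟩
    have h1 : 0 ≤ (1 + γ) * y / (y + γ) := by positivity
    have h2 : (1 + γ) * x / (x + γ) ≤ 1 + γ := by
      rw [div_le_iff₀ (by positivity)]
      gcongr
      linarith
    have h3 : 0 ≤ (1 + γ) * |x - y| := by positivity
    simp only [Surrogate.eval]
    linarith
  | laplace γ hγ =>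
    refine ⟨1, zero_le_one, fun x y hx hy => ?_⟩
    have h1 : Real.exp (-(y / γ)) ≤ 1 := Real.exp_le_one_iff.2 (by simp; positivity)
    have h2 := Real.exp_pos (-(x / γ))
    simp only [Surrogate.eval]
    linarith [abs_nonneg (x - y)]
  | logarithm γ hγ =>
    refine ⟨1 / γ, by positivity, fun x y hx hy => ?_⟩
    simp only [Surrogate.eval]
    rw [← Real.log_div (by positivity) (by positivity)]
    have h1 := Real.log_le_sub_one_of_pos (x := (γ + x) / (γ + y)) (by positivity)
    have h2 : (γ + x) / (γ + y) - 1 = (x - y) / (γ + y) := by field_simp; ring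
    have h3 : (x - y) / (γ + y) ≤ |x - y| / γ := by
      gcongr
      · exact le_abs_self _
      · linarith
    have h4 : 0 ≤ 1 / γ := by positivity
    have h5 : |x - y| / γ = 1 / γ * |x - y| := by ring
    linarith
  | weightedNuclear w hw =>
    refine ⟨w i, hw i, fun x y hx hy => ?_⟩
    simp only [Surrogate.eval]
    rw [← mul_sub]
    exact mul_le_mul_of_nonneg_left (by linarith [le_abs_self (x - y)]) (hw i)
  | schatten p hp hp1 =>
    refine ⟨1, zero_le_one, fun x y hx hy => ?_⟩
    simpa [Surrogate.eval] using Real.rpow_sub_rpow_le hp hp1 hx hy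
  | weightedSchatten w hw p hp hp1 =>
    refine ⟨w i, hw i, fun x y hx hy => ?_⟩
    simp only [Surrogate.eval]
    rw [← mul_sub]
    exact mul_le_mul_of_nonneg_left (Real.rpow_sub_rpow_le hp hp1 hx hy) (hw i)

end Eval
-- Frobenius norm, singular values and continuity of the φ-norm
section Norm

open scoped Matrix.Norms.Frobenius

variable {m n : Type*} [Fintype m] [Fintype n]

theorem _root_.Matrix.sq_frobenius_norm {R : Type*} [SeminormedAddCommGroup R]
    (A : Matrix m n R) : ‖A‖ ^ 2 = ∑ i, ∑ j, ‖A i j‖ ^ 2 := by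
  rw [Matrix.frobenius_norm_def, ← Real.sqrt_eq_rpow]
  simp_rw [Real.rpow_two]
  exact Real.sq_sqrt (by positivity)

theorem _root_.Matrix.norm_toEuclideanLin_apply_le_frobenius [DecidableEq n] {𝕜 : Type*} [RCLike 𝕜]
    (A : Matrix m n 𝕜) (x : EuclideanSpace 𝕜 n) :
    ‖Matrix.toEuclideanLin A x‖ ≤ ‖A‖ * ‖x‖ := by
  have h := Matrix.frobenius_norm_mul A (Matrix.replicateCol Unit x.ofLp)
  rw [← Matrix.replicateCol_mulVec, Matrix.frobenius_norm_replicateCol,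
    Matrix.frobenius_norm_replicateCol] at h
  exact h

theorem frobNorm_eq_norm (A : QMat m n) : frobNorm A = ‖A‖ := by
  rw [frobNorm, ← Matrix.sq_frobenius_norm, Real.sqrt_sq (norm_nonneg A)]

theorem norm_cdA_sq_add_norm_cdB_sq (q : ℍ[ℝ]) : ‖cdA q‖ ^ 2 + ‖cdB q‖ ^ 2 = ‖q‖ ^ 2 := by
  rw [← Complex.normSq_eq_norm_sq, ← Complex.normSq_eq_norm_sq, sq ‖q‖,
    ← Quaternion.normSq_eq_norm_mul_self, Quaternion.normSq_def', Complex.normSq_apply,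
    Complex.normSq_apply]
  simp only [cdA, cdB]
  ring

theorem norm_complexAdjoint (Q : QMat m n) : ‖complexAdjoint Q‖ = √2 * ‖Q‖ := by
  have h : ‖complexAdjoint Q‖ ^ 2 = 2 * ‖Q‖ ^ 2 := by
    rw [Matrix.sq_frobenius_norm, Matrix.sq_frobenius_norm]
    simp only [complexAdjoint, Fintype.sum_sum_type, Matrix.fromBlocks_apply₁₁,
      Matrix.fromBlocks_apply₁₂, Matrix.fromBlocks_apply₂₁, Matrix.fromBlocks_apply₂₂,
      Matrix.map_apply, norm_neg, norm_star, ← Finset.sum_add_distrib, Finset.mul_sum]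
    refine Finset.sum_congr rfl fun i _ => Finset.sum_congr rfl fun j _ => ?_
    rw [← norm_cdA_sq_add_norm_cdB_sq]
    ring
  rw [← Real.sqrt_sq (norm_nonneg (complexAdjoint Q)), h, Real.sqrt_mul zero_le_two,
    Real.sqrt_sq (norm_nonneg Q)]

theorem complexAdjoint_sub {m n : Type*} (A B : QMat m n) :
    complexAdjoint (A - B) = complexAdjoint A - complexAdjoint B := by
  ext (i | i) (j | j) <;> apply Complex.ext <;> simp [complexAdjoint, cdA, cdB] <;> ring

variable [DecidableEq n]

theorem singularValue_nonneg (A : QMat m n) (i : ℕ) : 0 ≤ singularValue A i :=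
  LinearMap.singularValues_nonneg _ _

/-- Weyl's inequality for the complex adjoint, with the operator norm bounded by the Frobenius norm.
The adjoint repeats every entry's components twice, hence `√2`; a sharp constant is not needed. -/
theorem abs_singularValue_sub_le (A B : QMat m n) (i : ℕ) :
    |singularValue A i - singularValue B i| ≤ √2 * ‖A - B‖ := by
  have key : ∀ A B : QMat m n, singularValue A i ≤ singularValue B i + √2 * ‖A - B‖ := by
    intro A B
    refine LinearMap.singularValues_le_add _ _ (fun x => ?_) (by positivity) _
    rw [← LinearMap.sub_apply, ← map_sub, ← norm_complexAdjoint, complexAdjoint_sub]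
    exact Matrix.norm_toEuclideanLin_apply_le_frobenius _ _
  rw [abs_sub_le_iff]
  have h1 := key A B
  have h2 := key B A
  rw [norm_sub_rev] at h2
  constructor <;> linarith

theorem continuous_singularValue (i : ℕ) : Continuous fun A : QMat m n => singularValue A i :=
  (LipschitzWith.of_dist_le_mul (K := ⟨√2, Real.sqrt_nonneg 2⟩) fun A B => by
    rw [Real.dist_eq, dist_eq_norm]
    exact abs_singularValue_sub_le A B i).continuous

theorem continuous_phiNorm (φ : Surrogate) : Continuous (phiNorm φ : QMat m n → ℝ) :=
  continuous_finsetSum _ fun i _ => (φ.continuousOn_eval i).comp_continuous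
    (continuous_singularValue i) fun A => singularValue_nonneg A i

theorem exists_phiNorm_sub_le (φ : Surrogate) :
    ∃ C : ℝ, 0 ≤ C ∧ ∀ A B : QMat m n, phiNorm φ A - phiNorm φ B ≤ C * (1 + √2 * ‖A - B‖) := by
  choose C hC h using φ.exists_eval_sub_le
  refine ⟨_,
    Finset.sum_nonneg (s := Finset.range (min (Fintype.card m) (Fintype.card n))) fun i _ => hC i, fun A B => ?_⟩
  rw [phiNorm, phiNorm, ← Finset.sum_sub_distrib, Finset.sum_mul]
  refine Finset.sum_le_sum fun i _ => (h i _ _ (singularValue_nonneg A i)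
    (singularValue_nonneg B i)).trans ?_
  exact mul_le_mul_of_nonneg_left (by linarith [abs_singularValue_sub_le A B i]) (hC i)

theorem eventually_phiNorm_ge (φ : Surrogate) (X : QMat m n) :
    ∃ L : ℝ, 0 ≤ L ∧ ∀ᶠ Y in 𝓝 X, phiNorm φ X - L * ‖Y - X‖ ≤ phiNorm φ Y := by
  choose L hL h using fun i => φ.eventually_eval_ge i (singularValue_nonneg X i)
  refine ⟨_,
    Finset.sum_nonneg (s := Finset.range (min (Fintype.card m) (Fintype.card n))) fun i _ => mul_nonneg (hL i) (Real.sqrt_nonneg 2), ?_⟩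
  filter_upwards [(Finset.eventually_all (Finset.range _)).2 fun i _ =>
    (continuous_singularValue i).continuousAt.eventually (h i)] with Y hY
  rw [phiNorm, phiNorm, Finset.sum_mul, ← Finset.sum_sub_distrib]
  refine Finset.sum_le_sum fun i hi => le_trans ?_ (hY i hi (singularValue_nonneg Y i))
  have := mul_le_mul_of_nonneg_left (abs_singularValue_sub_le Y X i) (hL i)
  linarith

end Norm
-- Subgradients from proximal minimization
section Subdifferential

open scoped Matrix.Norms.Frobenius

variable {m n : Type*} [Fintype m] [Fintype n]

theorem _root_.Quaternion.re_sum {ι : Type*} (s : Finset ι) (g : ι → ℍ[ℝ]) :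
    (∑ i ∈ s, g i).re = ∑ i ∈ s, (g i).re :=
  map_sum (QuaternionAlgebra.reₗ (-1 : ℝ) 0 (-1)) g s

theorem sq_norm_add (A B : QMat m n) :
    ‖A + B‖ ^ 2 = ‖A‖ ^ 2 + 2 * (qinner A B).re + ‖B‖ ^ 2 := by
  have h (x y : ℍ[ℝ]) : ‖x + y‖ ^ 2 = ‖x‖ ^ 2 + 2 * (star x * y).re + ‖y‖ ^ 2 := by
    simp only [sq, ← Quaternion.normSq_eq_norm_mul_self, Quaternion.normSq_def']
    simp
    ring
  have hre : (qinner A B).re = ∑ i, ∑ j, (star (A i j) * B i j).re := by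
    simp only [qinner, Quaternion.re_sum]
  rw [Matrix.sq_frobenius_norm, Matrix.sq_frobenius_norm, Matrix.sq_frobenius_norm, hre]
  simp only [Finset.mul_sum, ← Finset.sum_add_distrib, Matrix.add_apply, h]

theorem re_qinner_smul_left (c : ℝ) (A B : QMat m n) :
    (qinner (c • A) B).re = c * (qinner A B).re := by
  simp [qinner, ← Finset.smul_sum]

/-- A local minimizer `X` of `Y ↦ f Y + c / 2 * ‖Z - Y‖ ^ 2` has the regular subgradient
`c • (Z - X)`. -/
theorem isRegularSubgradient_of_prox {f : QMat m n → ℝ} {X Z : QMat m n} {c : ℝ}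
    (h : ∀ᶠ Y in 𝓝 X, f X + c / 2 * ‖Z - X‖ ^ 2 ≤ f Y + c / 2 * ‖Z - Y‖ ^ 2) :
    IsRegularSubgradient f X (c • (Z - X)) := by
  intro ε hε
  -- Expanding `‖(Z - X) - (Y - X)‖²` leaves the error `c/2 ‖Y - X‖²`, which is then at most `ε‖Y -
  -- X‖`.
  have hsmall : ∀ᶠ Y in 𝓝 X, c / 2 * ‖Y - X‖ < ε := by
    have : Continuous fun Y : QMat m n => c / 2 * ‖Y - X‖ := by fun_prop
    exact this.continuousAt.eventually_lt continuousAt_const (by simpa using hε)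
  filter_upwards [h, hsmall] with Y hY hYε
  rw [frobNorm_eq_norm, re_qinner_smul_left]
  have h1 := sq_norm_add (Z - X) (-(Y - X))
  have h2 : (qinner (Z - X) (-(Y - X))).re = -(qinner (Z - X) (Y - X)).re := by
    simp [qinner, -neg_sub]
  rw [h2, norm_neg, show Z - X + -(Y - X) = Z - Y by abel] at h1
  rw [h1] at hY
  have h3 := mul_le_mul_of_nonneg_right hYε.le (norm_nonneg (Y - X))
  nlinarith

/-- A continuous function that decreases at most linearly near `X` has a subgradient at `X`. -/
theorem subdifferential_nonempty {f : QMat m n → ℝ} (hf : Continuous f) {X : QMat m n} {L : ℝ}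
    (hL : 0 ≤ L) (h : ∀ᶠ Y in 𝓝 X, f X - L * ‖Y - X‖ ≤ f Y) : (subdifferential f X).Nonempty := by
  have : ProperSpace (QMat m n) := FiniteDimensional.proper ℝ _
  obtain ⟨δ, hδ, hball⟩ := Metric.eventually_nhds_iff_ball.1 h
  -- Minimize `f + c/2 ‖X - ·‖²` on the closed ball of radius `δ/2`, with `c = s + s₀`. The shift
  -- `s₀` makes `c` so large that the minimizer is interior, hence a local minimizer.
  obtain ⟨s₀, hs₀⟩ := exists_nat_gt (2 * L / (δ / 2))
  have key : ∀ s : ℕ, ∃ Y : QMat m n, ((s + s₀ : ℕ) : ℝ) * ‖X - Y‖ ≤ 2 * L ∧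
      IsRegularSubgradient f Y (((s + s₀ : ℕ) : ℝ) • (X - Y)) := by
    intro s
    set c : ℝ := ((s + s₀ : ℕ) : ℝ) with hc
    have hc0 : 2 * L / (δ / 2) < c := hs₀.trans_le (by rw [hc]; exact_mod_cast Nat.le_add_left _ _)
    have hcpos : 0 < c := lt_of_le_of_lt (by positivity) hc0
    obtain ⟨Y, hY, hmin⟩ := (isCompact_closedBall X (δ / 2)).exists_isMinOn
      (f := fun Y => f Y + c / 2 * ‖X - Y‖ ^ 2) ⟨X, Metric.mem_closedBall_self (by positivity)⟩
      (by fun_prop)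
    have hYX := hmin (Metric.mem_closedBall_self (by positivity : 0 ≤ δ / 2))
    have hYb : ‖Y - X‖ ≤ δ / 2 := by simpa [dist_eq_norm] using hY
    have hfY := hball Y (Metric.closedBall_subset_ball (by linarith) hY)
    simp only [Set.mem_ofPred_eq, sub_self, norm_zero] at hYX
    rw [norm_sub_rev] at hYb hfY
    -- Comparison with `X` gives `c/2 ‖X - Y‖² ≤ f X - f Y ≤ L‖X - Y‖`. This bounds the subgradients
    -- `c (X - Y)` and forces `Y → X` as `c → ∞`.
    have hle : c * ‖X - Y‖ ≤ 2 * L := by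
      rcases (norm_nonneg (X - Y)).eq_or_lt with h0 | h0
      · rw [← h0]; linarith
      · refine le_of_mul_le_mul_right ?_ h0
        nlinarith
    refine ⟨Y, hle, isRegularSubgradient_of_prox ?_⟩
    have hlt : Y ∈ Metric.ball X (δ / 2) := by
      rw [Metric.mem_ball, dist_eq_norm, norm_sub_rev]
      rw [div_lt_iff₀ (by positivity)] at hc0
      exact lt_of_mul_lt_mul_left (hle.trans_lt hc0) hcpos.le
    filter_upwards [Metric.isOpen_ball.mem_nhds hlt] with Y' hY'
    exact hmin (Metric.ball_subset_closedBall hY')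
  choose Y hY hsub using key
  have hcast : Tendsto (fun s : ℕ => ((s + s₀ : ℕ) : ℝ)) atTop atTop :=
    tendsto_natCast_atTop_atTop.comp (tendsto_add_atTop_nat s₀)
  have hYX : Tendsto Y atTop (𝓝 X) := by
    refine tendsto_iff_norm_sub_tendsto_zero.2 ?_
    refine squeeze_zero' (Eventually.of_forall fun _ => norm_nonneg _) ?_
      (hcast.const_div_atTop (2 * L))
    filter_upwards [hcast.eventually_gt_atTop 0] with s hs
    rw [le_div_iff₀ hs, norm_sub_rev, mul_comm]
    exact hY s
  obtain ⟨G, -, ψ, hψ, hG⟩ := (isCompact_closedBall (0 : QMat m n) (2 * L)).tendsto_subseq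
    (x := fun s => ((s + s₀ : ℕ) : ℝ) • (X - Y s)) fun s => by
      rw [mem_closedBall_zero_iff, norm_smul, Real.norm_natCast]
      exact hY s
  have hYψ := hYX.comp hψ.tendsto_atTop
  exact ⟨G, fun s => Y (ψ s), _, hYψ, (hf.tendsto X).comp hYψ, fun s => hsub (ψ s), hG⟩

end Subdifferential
-- Consequences of the Q-step and the multiplier update
section ADMM

open scoped Matrix.Norms.Frobenius

variable {N : ℕ} {I : Fin N → ℕ}

/-- The Lagrangian is separable over the modes, so a joint minimizer minimizes each block. -/
theorem lagrangian_update (φ : Surrogate) (α : Fin N → ℝ) (P : QTensor I)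
    (Q F : ∀ k, UnfoldMat I k) (β : Fin N → ℝ) (k : Fin N) (Y : UnfoldMat I k) :
    lagrangian φ α P (Function.update Q k Y) F β - lagrangian φ α P Q F β =
      (α k * phiNorm φ Y + (qinner (F k) (unfold k P - Y)).re
        + β k / 2 * frobNorm (unfold k P - Y) ^ 2) -
      (α k * phiNorm φ (Q k) + (qinner (F k) (unfold k P - Q k)).re
        + β k / 2 * frobNorm (unfold k P - Q k) ^ 2) := by
  rw [lagrangian, lagrangian, ← Finset.sum_sub_distrib, Finset.sum_eq_single k]
  · rw [Function.update_self]
  · intro l _ hl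
    rw [Function.update_of_ne hl, sub_self]
  · simp

namespace IsADMMSequence

variable {φ : Surrogate} {α : Fin N → ℝ} {Ω : Set (∀ l, Fin (I l))} {O : QTensor I}
  {β : ℕ → Fin N → ℝ} {P : ℕ → QTensor I} {Q F : ℕ → ∀ k, UnfoldMat I k}

theorem multiplier_eq (h : IsADMMSequence φ α Ω O β P Q F) (τ : ℕ) (k : Fin N)
    (hβ : β τ k ≠ 0) : F (τ + 1) k =
      β τ k • ((β τ k)⁻¹ • F τ k + unfold k (P (τ + 1)) - Q (τ + 1) k) := by
  rw [h.update_F, add_sub_assoc, smul_add, smul_inv_smul₀ hβ, ← neg_sub (Q (τ + 1) k), smul_neg,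
    sub_eq_add_neg]

/-- Completing the square turns the Q-step into a proximal problem; the extra term `β/2 ‖β⁻¹ F‖²`
does not depend on `Y`. -/
theorem prox_le (h : IsADMMSequence φ α Ω O β P Q F) (τ : ℕ) (k : Fin N) (hβ : β τ k ≠ 0)
    (Y : UnfoldMat I k) :
    α k * phiNorm φ (Q (τ + 1) k) +
      β τ k / 2 * ‖(β τ k)⁻¹ • F τ k + unfold k (P (τ + 1)) - Q (τ + 1) k‖ ^ 2 ≤
    α k * phiNorm φ Y + β τ k / 2 * ‖(β τ k)⁻¹ • F τ k + unfold k (P (τ + 1)) - Y‖ ^ 2 := by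
  have h1 := h.update_Q τ (Function.update (Q (τ + 1)) k Y)
  have h2 := lagrangian_update φ α (P (τ + 1)) (Q (τ + 1)) (F τ) (β τ) k Y
  have h3 (Y : UnfoldMat I k) : β τ k / 2 * ‖(β τ k)⁻¹ • F τ k + unfold k (P (τ + 1)) - Y‖ ^ 2 =
      β τ k / 2 * ‖(β τ k)⁻¹ • F τ k‖ ^ 2 + ((qinner (F τ k) (unfold k (P (τ + 1)) - Y)).re
        + β τ k / 2 * frobNorm (unfold k (P (τ + 1)) - Y) ^ 2) := by
    rw [add_sub_assoc, sq_norm_add, re_qinner_smul_left, frobNorm_eq_norm]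
    field_simp
    ring
  rw [h3, h3]
  linarith

theorem isRegularSubgradient (h : IsADMMSequence φ α Ω O β P Q F) (τ : ℕ) (k : Fin N)
    (hβ : β τ k ≠ 0) (hα : 0 < α k) :
    IsRegularSubgradient (phiNorm φ) (Q (τ + 1) k) ((α k)⁻¹ • F (τ + 1) k) := by
  rw [h.multiplier_eq τ k hβ, smul_smul]
  refine isRegularSubgradient_of_prox (Eventually.of_forall fun Y => ?_)
  have := mul_le_mul_of_nonneg_left (h.prox_le τ k hβ Y) (inv_nonneg.2 hα.le)
  rw [mul_add, mul_add, inv_mul_cancel_left₀ hα.ne', inv_mul_cancel_left₀ hα.ne'] at this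
  have hassoc (x : ℝ) : (α k)⁻¹ * (β τ k / 2 * x) = (α k)⁻¹ * β τ k / 2 * x := by ring
  rw [hassoc, hassoc] at this
  exact this

/-- The competitor is the proximal centre `Z`, where the quadratic term vanishes, and `‖Z - Q‖ =
‖F‖/β`. -/
theorem norm_multiplier_div_sq_le (h : IsADMMSequence φ α Ω O β P Q F) (k : Fin N)
    (hα : 0 ≤ α k) : ∃ C : ℝ, 0 ≤ C ∧ ∀ τ, 0 < β τ k →
      (‖F (τ + 1) k‖ / β τ k) ^ 2 ≤ C / β τ k * (1 + √2 * (‖F (τ + 1) k‖ / β τ k)) := by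
  obtain ⟨C, hC, hle⟩ := exists_phiNorm_sub_le (m := Fin (I k)) (n := ColIndex I k) φ
  refine ⟨2 * (α k * C), by positivity, fun τ hβ => ?_⟩
  set Z := (β τ k)⁻¹ • F τ k + unfold k (P (τ + 1)) with hZ
  have h1 : ‖F (τ + 1) k‖ / β τ k = ‖Z - Q (τ + 1) k‖ := by
    rw [h.multiplier_eq τ k hβ.ne', norm_smul, Real.norm_of_nonneg hβ.le,
      mul_div_cancel_left₀ _ hβ.ne']
  have h2 := h.prox_le τ k hβ.ne' Z
  rw [← hZ, sub_self, norm_zero] at h2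
  have h3 := mul_le_mul_of_nonneg_left (hle Z (Q (τ + 1) k)) hα
  rw [h1, div_mul_eq_mul_div, le_div_iff₀ hβ]
  linarith

theorem tendsto_norm_multiplier_div (h : IsADMMSequence φ α Ω O β P Q F) (k : Fin N)
    (hα : 0 ≤ α k) (hβ : Tendsto (fun τ => β τ k) atTop atTop) :
    Tendsto (fun τ => ‖F (τ + 1) k‖ / β τ k) atTop (𝓝 0) := by
  obtain ⟨C, hC, hle⟩ := h.norm_multiplier_div_sq_le k hα
  -- From `d² ≤ c (1 + √2 d)` and `√2 c d ≤ d²/2 + c²` follows `d² ≤ 2c + 2c²`.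
  have hlim : Tendsto (fun τ => √(2 * (C / β τ k) + 2 * (C / β τ k) ^ 2)) atTop (𝓝 0) := by
    have hc := hβ.const_div_atTop C
    have := ((hc.const_mul 2).add ((hc.pow 2).const_mul 2)).sqrt
    simpa using this
  refine squeeze_zero' ?_ ?_ hlim
  · filter_upwards [hβ.eventually_gt_atTop 0] with τ hτ using by positivity
  · filter_upwards [hβ.eventually_gt_atTop 0] with τ hτ
    refine Real.le_sqrt_of_sq_le ?_
    have h1 := hle τ hτ
    set d := ‖F (τ + 1) k‖ / β τ k
    set c := C / β τ k
    have h2 : (√2) ^ 2 = 2 := Real.sq_sqrt zero_le_two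
    nlinarith [sq_nonneg (d - √2 * c)]

theorem tendsto_unfold_sub (h : IsADMMSequence φ α Ω O β P Q F) (k : Fin N)
    (hα : 0 ≤ α k) (hβ_pos : ∀ τ, 0 < β τ k) (hβ_mono : ∀ τ, β τ k ≤ β (τ + 1) k)
    (hβ : Tendsto (fun τ => β τ k) atTop atTop) :
    Tendsto (fun τ => unfold k (P τ) - Q τ k) atTop (𝓝 0) := by
  have hd := h.tendsto_norm_multiplier_div k hα hβ
  -- With a shift by 2, both multipliers in the difference come from an update; the arbitrary `F 0`
  -- does not occur.
  refine (tendsto_add_atTop_iff_nat 2).1 (tendsto_zero_iff_norm_tendsto_zero.2 ?_)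
  refine squeeze_zero (fun _ => norm_nonneg _) (fun τ => ?_)
    (by simpa using ((tendsto_add_atTop_iff_nat 1).2 hd).add hd)
  have hF := h.update_F (τ + 1) k
  have hb := hβ_pos (τ + 1)
  have h1 : β (τ + 1) k • (unfold k (P (τ + 2)) - Q (τ + 2) k) = F (τ + 2) k - F (τ + 1) k := by
    rw [hF, ← neg_sub (Q (τ + 2) k), smul_neg]
    abel
  have h2 : β (τ + 1) k * ‖unfold k (P (τ + 2)) - Q (τ + 2) k‖ ≤ ‖F (τ + 2) k‖ + ‖F (τ + 1) k‖ := by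
    rw [← Real.norm_of_nonneg hb.le, ← norm_smul, h1]
    exact norm_sub_le _ _
  calc _ ≤ (‖F (τ + 2) k‖ + ‖F (τ + 1) k‖) / β (τ + 1) k := by
        rw [le_div_iff₀ hb, mul_comm]; exact h2
    _ ≤ _ := by
        rw [add_div]
        gcongr
        · exact hβ_pos τ
        · exact hβ_mono τ

/-- Without the φ-term the Q-step is a pure least-squares problem, so its residual is zero. -/
theorem multiplier_eq_zero (h : IsADMMSequence φ α Ω O β P Q F) (τ : ℕ) (k : Fin N)
    (hβ : 0 < β τ k) (hα : α k = 0) : F (τ + 1) k = 0 := by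
  have h1 := h.prox_le τ k hβ.ne' ((β τ k)⁻¹ • F τ k + unfold k (P (τ + 1)))
  rw [hα, zero_mul, zero_mul, sub_self, norm_zero] at h1
  rw [h.multiplier_eq τ k hβ.ne']
  have h2 : ‖(β τ k)⁻¹ • F τ k + unfold k (P (τ + 1)) - Q (τ + 1) k‖ ^ 2 ≤ 0 := by
    by_contra! h3
    nlinarith [mul_pos hβ h3]
  rw [norm_eq_zero.1 (pow_eq_zero_iff two_ne_zero |>.1 (h2.antisymm (sq_nonneg _))), smul_zero]

end IsADMMSequence

end ADMM

/-! ### Penalty growth, continuity of the tensor operations, and the KKT conditions -/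

theorem tendsto_atTop_of_summable_add_div {b : ℕ → ℝ} (hpos : ∀ τ, 0 < b τ)
    (hmono : ∀ τ, b τ ≤ b (τ + 1))
    (hsum : Summable fun τ : ℕ => (b (τ + 1) + b τ) / (2 * b τ ^ 2)) : Tendsto b atTop atTop := by
  have h1 : Tendsto (fun τ => (b τ)⁻¹) atTop (𝓝 0) := by
    -- By monotonicity each summand is at least `2b/(2b²) = 1/b`.
    refine squeeze_zero (fun τ => (inv_pos.2 (hpos τ)).le) (fun τ => ?_) hsum.tendsto_atTop_zero
    have := hpos τ
    rw [le_div_iff₀ (by positivity)]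
    field_simp
    linarith [hmono τ]
  have h2 : Tendsto (fun τ => (b τ)⁻¹) atTop (𝓝[>] 0) :=
    tendsto_nhdsWithin_iff.2 ⟨h1, Eventually.of_forall fun τ => inv_pos.2 (hpos τ)⟩
  exact h2.inv_tendsto_nhdsGT_zero.congr fun τ => inv_inv _

theorem continuous_unfold {N : ℕ} {I : Fin N → ℕ} (k : Fin N) :
    Continuous (unfold k : QTensor I → UnfoldMat I k) :=
  continuous_pi fun _ => continuous_pi fun _ => continuous_apply _

theorem continuous_restrict {N : ℕ} {I : Fin N → ℕ} (Ω : Set (∀ l, Fin (I l))) :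
    Continuous (restrict Ω : QTensor I → QTensor I) := by
  classical
  refine continuous_pi fun i => ?_
  by_cases hi : i ∈ Ω
  · simpa [restrict, hi] using continuous_apply i
  · simpa [restrict, hi] using continuous_const

end QTC

instance {m n : Type*} [Countable m] [Countable n] :
    FirstCountableTopology (QTC.QMat m n) :=
  inferInstanceAs (FirstCountableTopology (m → n → ℍ[ℝ]))

theorem mainTheorem1 {N : ℕ} {I : Fin N → ℕ} (φ : QTC.Surrogate)
    (α : Fin N → ℝ) (hα : ∀ k, 0 ≤ α k) (hα_sum : ∑ k, α k = 1)
    (Ω : Set (∀ l, Fin (I l))) (O : QTC.QTensor I)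
    (β : ℕ → Fin N → ℝ) (hβ_pos : ∀ τ k, 0 < β τ k) (hβ_mono : ∀ τ k, β τ k ≤ β (τ + 1) k)
    (P : ℕ → QTC.QTensor I) (Q F : ℕ → ∀ k, QTC.UnfoldMat I k)
    (hseq : QTC.IsADMMSequence φ α Ω O β P Q F)
    (hβ_conv : ∀ k, Summable fun τ : ℕ => (β (τ + 1) k + β τ k) / (2 * β τ k ^ 2))
    (Pstar : QTC.QTensor I) (Qstar Fstar : ∀ k, QTC.UnfoldMat I k)
    (hacc : MapClusterPt (Pstar, Qstar, Fstar) atTop fun τ => (P τ, Q τ, F τ)) :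
    (∀ k, QTC.unfold k Pstar = Qstar k) ∧
    QTC.restrict Ω Pstar = QTC.restrict Ω O ∧
    ∀ k, ∃ G ∈ QTC.subdifferential (QTC.phiNorm φ) (Qstar k), Fstar k = α k • G := by
  obtain ⟨ψ, hψ, hlim⟩ := hacc.tendsto_subseq
  -- Dropping the first term of the subsequence avoids the arbitrary iterate at time 0, so every
  -- remaining term results from an update.
  have hψ1 : ∀ s, ∃ τ, ψ (s + 1) = τ + 1 := fun s =>
    Nat.exists_eq_succ_of_ne_zero ((Nat.zero_le _).trans_lt (hψ (Nat.lt_succ_self s))).ne'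
  choose τ hτ using hψ1
  have hτ_lim : Tendsto (fun s => τ s + 1) atTop atTop := by
    simp_rw [← hτ]
    exact hψ.tendsto_atTop.comp (tendsto_add_atTop_nat 1)
  have hlim' : Tendsto (fun s => (P (τ s + 1), Q (τ s + 1), F (τ s + 1))) atTop
      (𝓝 (Pstar, Qstar, Fstar)) := by
    simp_rw [← hτ]
    exact hlim.comp (tendsto_add_atTop_nat 1)
  have hP : Tendsto (fun s => P (τ s + 1)) atTop (𝓝 Pstar) := hlim'.fst_nhds
  have hQ k : Tendsto (fun s => Q (τ s + 1) k) atTop (𝓝 (Qstar k)) :=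
    tendsto_pi_nhds.1 hlim'.snd_nhds.fst_nhds k
  have hF k : Tendsto (fun s => F (τ s + 1) k) atTop (𝓝 (Fstar k)) :=
    tendsto_pi_nhds.1 hlim'.snd_nhds.snd_nhds k
  refine ⟨fun k => ?_, ?_, fun k => ?_⟩
  · have hβ := QTC.tendsto_atTop_of_summable_add_div (fun τ => hβ_pos τ k) (fun τ => hβ_mono τ k)
      (hβ_conv k)
    have h0 := (hseq.tendsto_unfold_sub k (hα k) (fun τ => hβ_pos τ k) (fun τ => hβ_mono τ k)
      hβ).comp hτ_lim
    have h1 := (((QTC.continuous_unfold k).tendsto Pstar).comp hP).sub (hQ k)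
    exact sub_eq_zero.1 (tendsto_nhds_unique h1 h0)
  · refine tendsto_nhds_unique (((QTC.continuous_restrict Ω).tendsto Pstar).comp hP) ?_
    refine tendsto_const_nhds.congr fun s => ?_
    obtain ⟨T, -, hT⟩ := hseq.update_P (τ s)
    funext i
    by_cases hi : i ∈ Ω <;> simp [QTC.restrict, hT, hi]
  · rcases (hα k).eq_or_lt with h0 | hpos
    -- For `α k = 0` the set `α k • ∂` is `{0}` only if the subdifferential is nonempty, so a
    -- subgradient has to be produced.
    · obtain ⟨L, hL, hcalm⟩ := QTC.eventually_phiNorm_ge φ (Qstar k)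
      obtain ⟨G, hG⟩ := QTC.subdifferential_nonempty (QTC.continuous_phiNorm φ) hL hcalm
      refine ⟨G, hG, ?_⟩
      rw [← h0, zero_smul]
      refine tendsto_nhds_unique (hF k) (tendsto_const_nhds.congr fun s => ?_)
      exact (hseq.multiplier_eq_zero _ k (hβ_pos _ k) h0.symm).symm
    · refine ⟨(α k)⁻¹ • Fstar k, ⟨fun s => Q (τ s + 1) k, fun s => (α k)⁻¹ • F (τ s + 1) k, hQ k,
        ((QTC.continuous_phiNorm φ).tendsto _).comp (hQ k), fun s =>
          hseq.isRegularSubgradient _ k (hβ_pos _ k).ne' hpos, (hF k).const_smul _⟩, ?_⟩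
      rw [smul_inv_smul₀ hpos.ne']
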